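/- **Definitions.** A *spectral triple* $(A,\mathcal H,D)$ consists of a unital $C^*$-algebra $A$, a faithful unital $*$-representation $\pi$ of $A$ on a complex Hilbert space $\mathcal H$, and a selfadjoint operator $D:\mathrm{Dom}(D)\subseteq\mathcal H\to\mathcal H$ such that (ST1) $D$ has compact resolvent, i.e. $R_\lambda(D)=(D-\lambda)^{-1}$ is compact for all $\lambda\in\mathbb C\setminus\sigma(D)$, and (ST2) the set $A^\infty$ of all $a\in A$ for which $[D,\pi(a)]$ is densely defined and extends to a bounded operator on $\mathcal H$ is dense in $A$. An *isometric morphism* $(A_1,\mathcal H_1,D_1)\to(A_2,\mathcal H_2,D_2)$ is a pair $(\phi,I)$ of an injective unital $*$-homomorphism $\phi:A_1\to A_2$ and a linear isometry $I:\mathcal H_1\to\mathcal H_2$ with $\phi(A_1^\infty)\subseteq A_2^\infty$, $I\pi_1(a)=\pi_2(\phi(a))I$ for all $a\in A_1$, $I(\mathrm{Dom}(D_1))\subseteq\mathrm{Dom}(D_2)$, and $ID_1=D_2I$ on $\mathrm{Dom}(D_1)$. An *inductive system of spectral triples* indexed by $\mathbb N$ consists of spectral triples $(A_j,\mathcal H_j,D_j)$,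 $j\in\mathbb N$, and isometric morphisms $(\phi_{j,k},I_{j,k})$ from $(A_j,\mathcal H_j,D_j)$ to $(A_k,\mathcal H_k,D_k)$ for $j\le k$, with $\phi_{k,l}\phi_{j,k}=\phi_{j,l}$ and $I_{k,l}I_{j,k}=I_{j,l}$ for $j\le k\le l$. Its *inductive realization* $(A,\mathcal H,D)$ consists of the inductive limits $A=\varinjlim A_j$ and $\mathcal H=\varinjlim\mathcal H_j$ in the categories of $C^*$-algebras and Hilbert spaces, with the canonical injective $*$-homomorphisms $\phi_j:A_j\to A$, the canonical isometries $I_j:\mathcal H_j\to\mathcal H$ and the unique representation $\pi$ of $A$ on $\mathcal H$ with $\pi(\phi_j(a))I_j=I_j\pi_j(a)$ for $a\in A_j$, and of the selfadjoint operator $D$ that is the closure of the operator with domain $\bigcup_j I_j(\mathrm{Dom}(D_j))$ given by $I_j\xi\mapsto I_jD_j\xi$ for $\xi\in\mathrm{Dom}(D_j)$. **Theorem.** Let $\{(A_j,\mathcal H_j,D_j),(\phi_{j,k},I_{j,k})\}_{\mathbb N}$ be an inductive system of spectral triples with inductive realization $(A,\mathcal H,D)$. The following conditions are equivalent: (i)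 $D$ has compact resolvent; (ii) $I_jR_\lambda(D_j)I_j^*\to R_\lambda(D)$ in operator norm as $j\to\infty$, for every $\lambda\in\mathbb C\setminus\mathbb R$; (iii) $I_jR_\lambda(D_j)I_j^*\to R_\lambda(D)$ in operator norm as $j\to\infty$, for some $\lambda\in\mathbb C\setminus\mathbb R$; (iv) $I_jf(D_j)I_j^*\to f(D)$ in operator norm as $j\to\infty$, for every continuous function $f:\mathbb R\to\mathbb C$ vanishing at infinity, where $f(D_j)$ and $f(D)$ are given by the functional calculus of selfadjoint operators. -/

import Mathlib

open Filter Topology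
open scoped ZeroAtInfty InnerProductSpace

noncomputable section

namespace SpectralLimit

section Unbounded

variable {H : Type*} [NormedAddCommGroup H] [InnerProductSpace ℂ H]

/-- `R` is the bounded two-sided inverse of the (unbounded) operator `D - z`:
`R` maps `H` into `Dom D`, `(D - z) R = 1` on `H` and `R (D - z) = 1` on `Dom D`. -/
def IsResolventAt (D : H →ₗ.[ℂ] H) (z : ℂ) (R : H →L[ℂ] H) : Prop :=
  (∀ y : H, ∃ h : R y ∈ D.domain, D ⟨R y, h⟩ - z • R y = y) ∧
    ∀ x : D.domain, R (D x - z • (x : H)) = x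

/-- The resolvent set `ℂ ∖ σ(D)` of an unbounded operator. -/
def resolvSet (D : H →ₗ.[ℂ] H) : Set ℂ := {z | ∃ R : H →L[ℂ] H, IsResolventAt D z R}

open Classical in
/-- The resolvent `R_z(D) = (D - z)⁻¹`, for `z` in the resolvent set
(and the value `0` off the resolvent set). -/
def resolventOp (D : H →ₗ.[ℂ] H) (z : ℂ) : H →L[ℂ] H :=
  if h : ∃ R : H →L[ℂ] H, IsResolventAt D z R then h.choose else 0

/-- `R_z(D)` is determined by its defining property. -/
theorem IsResolventAt.resolventOp_eq {D : H →ₗ.[ℂ] H} {z : ℂ} {R : H →L[ℂ] H}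
    (hR : IsResolventAt D z R) : resolventOp D z = R := by
  have h : ∃ R : H →L[ℂ] H, IsResolventAt D z R := ⟨R, hR⟩
  have h' : IsResolventAt D z (resolventOp D z) := by
    rw [resolventOp, dif_pos h]
    exact h.choose_spec
  ext y
  obtain ⟨hy, e⟩ := hR.1 y
  have := h'.2 ⟨R y, hy⟩
  simpa [e] using this

/-- `D` has compact resolvent. -/
def HasCompactResolvent (D : H →ₗ.[ℂ] H) : Prop :=
  ∀ z ∈ resolvSet D, IsCompactOperator (resolventOp D z)

/-- The operator `f(D)`, for a selfadjoint operator `D` and a continuous function `f : ℝ → ℂ`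
vanishing at infinity. The map `x ↦ (x - i)⁻¹` is a homeomorphism of `ℝ` onto the circle with
diameter `[0, i]` without the point `0`; hence `f(x) = g((x - i)⁻¹)` for the function `g`
with `g(z) = f(z⁻¹ + i)` for `z ≠ 0` and `g(0) = 0`, which is continuous on the whole circle, and
`f(D) = g((D - i)⁻¹)` is computed by the continuous functional calculus of the bounded normal
operator `(D - i)⁻¹`, whose spectrum lies on that circle. -/
def funCalc [CompleteSpace H] (D : H →ₗ.[ℂ] H) (f : C₀(ℝ, ℂ)) : H →L[ℂ] H :=
  cfcₙ (fun z : ℂ => if z = 0 then 0 else f (z⁻¹ + Complex.I).re) (resolventOp D Complex.I)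

end Unbounded

/-- The set `A^∞` of all `a ∈ A` such that the commutator `[D, π(a)] = D π(a) - π(a) D`, with its
natural domain `{x ∈ Dom D | π(a) x ∈ Dom D}`, is densely defined and extends to a bounded operator
on the whole Hilbert space. -/
def smoothElements {A H : Type*} [CStarAlgebra A] [NormedAddCommGroup H] [InnerProductSpace ℂ H]
    [CompleteSpace H] (π : A →⋆ₐ[ℂ] (H →L[ℂ] H)) (D : H →ₗ.[ℂ] H) : Set A :=
  {a | Dense {x : H | x ∈ D.domain ∧ π a x ∈ D.domain} ∧
    ∃ T : H →L[ℂ] H, ∀ (x : H) (hx : x ∈ D.domain) (hax : π a x ∈ D.domain),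
      D ⟨π a x, hax⟩ - π a (D ⟨x, hx⟩) = T x}

/-- A spectral triple `(A, H, D)`: a unital C*-algebra `A`, a faithful unital *-representation `π`
of `A` on the Hilbert space `H`, and a selfadjoint operator `D` in `H` with compact resolvent for
which `A^∞` is dense in `A`. -/
structure SpectralTriple (A H : Type*) [CStarAlgebra A] [NormedAddCommGroup H]
    [InnerProductSpace ℂ H] [CompleteSpace H] where
  /-- the representation -/
  π : A →⋆ₐ[ℂ] (H →L[ℂ] H)
  faithful : Function.Injective π
  /-- the Dirac operator -/
  D : H →ₗ.[ℂ] H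
  selfAdjoint : IsSelfAdjoint D
  compactResolvent : HasCompactResolvent D
  dense_smooth : Dense (smoothElements π D)

/-- A morphism `(φ, I)` of spectral triples. -/
structure SpectralTriple.Hom {A₁ H₁ A₂ H₂ : Type*}
    [CStarAlgebra A₁] [NormedAddCommGroup H₁] [InnerProductSpace ℂ H₁] [CompleteSpace H₁]
    [CStarAlgebra A₂] [NormedAddCommGroup H₂] [InnerProductSpace ℂ H₂] [CompleteSpace H₂]
    (T₁ : SpectralTriple A₁ H₁) (T₂ : SpectralTriple A₂ H₂) where
  /-- the unital *-homomorphism -/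
  φ : A₁ →⋆ₐ[ℂ] A₂
  /-- the bounded operator -/
  I : H₁ →L[ℂ] H₂
  map_smooth : ∀ a ∈ smoothElements T₁.π T₁.D, φ a ∈ smoothElements T₂.π T₂.D
  intertwines : ∀ (a : A₁) (x : H₁), I (T₁.π a x) = T₂.π (φ a) (I x)
  map_domain : ∀ x ∈ T₁.D.domain, I x ∈ T₂.D.domain
  map_dirac : ∀ x : T₁.D.domain, I (T₁.D x) = T₂.D ⟨I x, map_domain x x.2⟩

/-- A morphism `(φ, I)` is isometric if `φ` is injective and `I` is an isometry. -/
def SpectralTriple.Hom.IsIsometric {A₁ H₁ A₂ H₂ : Type*}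
    [CStarAlgebra A₁] [NormedAddCommGroup H₁] [InnerProductSpace ℂ H₁] [CompleteSpace H₁]
    [CStarAlgebra A₂] [NormedAddCommGroup H₂] [InnerProductSpace ℂ H₂] [CompleteSpace H₂]
    {T₁ : SpectralTriple A₁ H₁} {T₂ : SpectralTriple A₂ H₂} (F : T₁.Hom T₂) : Prop :=
  Function.Injective F.φ ∧ Isometry F.I

/-- A (countable) inductive system of spectral triples, indexed by `ℕ`, with isometric connecting
morphisms `(φ_{j,k}, I_{j,k})`. -/
structure InductiveSystem (A H : ℕ → Type*) [∀ j, CStarAlgebra (A j)]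
    [∀ j, NormedAddCommGroup (H j)] [∀ j, InnerProductSpace ℂ (H j)]
    [∀ j, CompleteSpace (H j)] where
  /-- the spectral triples of the system -/
  triple : ∀ j, SpectralTriple (A j) (H j)
  /-- the connecting morphisms -/
  hom : ∀ j k, j ≤ k → (triple j).Hom (triple k)
  isometric : ∀ j k (h : j ≤ k), (hom j k h).IsIsometric
  φ_comp : ∀ j k l (hjk : j ≤ k) (hkl : k ≤ l) (a : A j),
    (hom k l hkl).φ ((hom j k hjk).φ a) = (hom j l (hjk.trans hkl)).φ a
  I_comp : ∀ j k l (hjk : j ≤ k) (hkl : k ≤ l) (x : H j),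
    (hom k l hkl).I ((hom j k hjk).I x) = (hom j l (hjk.trans hkl)).I x

/-- `(A', φ_j)` is the inductive limit of the C*-algebras `A_j`, `(H', I_j)` is the inductive limit
of the Hilbert spaces `H_j` (both are determined up to a unique isomorphism by the properties
below), and `π` is the inductive limit of the representations `π_j`, i.e. the unique representation
of `A'` on `H'` with `π(φ_j(a)) I_j = I_j π_j(a)`. The third member of the inductive realization,
the operator `D = lim D_j`, is constructed from these data below. -/
structure InductiveRealization {A H : ℕ → Type*} [∀ j, CStarAlgebra (A j)]
    [∀ j, NormedAddCommGroup (H j)] [∀ j, InnerProductSpace ℂ (H j)] [∀ j, CompleteSpace (H j)]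
    (S : InductiveSystem A H) (A' H' : Type*) [CStarAlgebra A'] [NormedAddCommGroup H']
    [InnerProductSpace ℂ H'] [CompleteSpace H'] where
  /-- the connecting *-monomorphisms of the limit C*-algebra -/
  φ : ∀ j, A j →⋆ₐ[ℂ] A'
  φ_injective : ∀ j, Function.Injective (φ j)
  φ_compat : ∀ j k (h : j ≤ k) (a : A j), φ k ((S.hom j k h).φ a) = φ j a
  φ_dense : Dense (⋃ j, Set.range (φ j))
  /-- the connecting isometries of the limit Hilbert space -/
  I : ∀ j, H j →L[ℂ] H'
  I_isometry : ∀ j, Isometry (I j)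
  I_compat : ∀ j k (h : j ≤ k) (x : H j), I k ((S.hom j k h).I x) = I j x
  I_dense : Dense (⋃ j, Set.range (I j))
  /-- the limit representation -/
  π : A' →⋆ₐ[ℂ] (H' →L[ℂ] H')
  π_compat : ∀ j (a : A j) (x : H j), π (φ j a) (I j x) = I j ((S.triple j).π a x)

namespace InductiveRealization

variable {A H : ℕ → Type*} [∀ j, CStarAlgebra (A j)]
  [∀ j, NormedAddCommGroup (H j)] [∀ j, InnerProductSpace ℂ (H j)] [∀ j, CompleteSpace (H j)]
  {S : InductiveSystem A H} {A' H' : Type*} [CStarAlgebra A'] [NormedAddCommGroup H']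
  [InnerProductSpace ℂ H'] [CompleteSpace H']

/-- The linear span of the pairs `(I_j ξ, I_j D_j ξ)`, `ξ ∈ Dom D_j`, `j ∈ ℕ`
(these pairs already form a linear subspace). -/
def coreGraph (L : InductiveRealization S A' H') : Submodule ℂ (H' × H') :=
  ⨆ j, (S.triple j).D.graph.map
    ((L.I j : H j →ₗ[ℂ] H').prodMap (L.I j : H j →ₗ[ℂ] H'))

/-- The operator `I_j ξ ↦ I_j D_j ξ` on the domain `⋃ j, I_j (Dom D_j)`. -/
def coreDirac (L : InductiveRealization S A' H') : H' →ₗ.[ℂ] H' := L.coreGraph.toLinearPMap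

/-- The operator `D = lim D_j` of the inductive realization: the closure of the operator
`I_j ξ ↦ I_j D_j ξ`. -/
def dirac (L : InductiveRealization S A' H') : H' →ₗ.[ℂ] H' := L.coreDirac.closure

/-- The operator `I_j T I_j^*` in the limit Hilbert space. -/
def lift (L : InductiveRealization S A' H') (j : ℕ) (T : H j →L[ℂ] H j) : H' →L[ℂ] H' :=
  L.I j ∘L T ∘L ContinuousLinearMap.adjoint (L.I j)

theorem mem_coreGraph (L : InductiveRealization S A' H') (p : H' × H') :
    p ∈ L.coreGraph ↔
      ∃ j, ∃ x : (S.triple j).D.domain, p = (L.I j x, L.I j ((S.triple j).D x)) := by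
  have hdir : Directed (· ≤ ·) fun j => (S.triple j).D.graph.map
      ((L.I j : H j →ₗ[ℂ] H').prodMap (L.I j : H j →ₗ[ℂ] H')) := by
    refine directed_of_isDirected_le fun j k hjk => ?_
    rintro _ ⟨⟨u, v⟩, hq, rfl⟩
    obtain ⟨x, rfl, rfl⟩ := (LinearPMap.mem_graph_iff _).1 hq
    refine ⟨((S.hom j k hjk).I x, (S.hom j k hjk).I ((S.triple j).D x)), ?_, ?_⟩
    · refine (LinearPMap.mem_graph_iff _).2
        ⟨⟨_, (S.hom j k hjk).map_domain x x.2⟩, rfl, ?_⟩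
      exact ((S.hom j k hjk).map_dirac x).symm
    · simp [L.I_compat j k hjk]
  rw [coreGraph, Submodule.mem_iSup_of_directed _ hdir]
  refine exists_congr fun j => ?_
  constructor
  · rintro ⟨⟨u, v⟩, hq, rfl⟩
    obtain ⟨x, rfl, rfl⟩ := (LinearPMap.mem_graph_iff _).1 hq
    exact ⟨x, rfl⟩
  · rintro ⟨x, rfl⟩
    exact ⟨(x, (S.triple j).D x), LinearPMap.mem_graph _ x, rfl⟩

/-- `coreDirac` is well defined: its graph is `coreGraph`, that is, its domain is
`⋃ j, I_j (Dom D_j)` and it maps `I_j ξ` to `I_j D_j ξ`. -/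
theorem graph_coreDirac (L : InductiveRealization S A' H') :
    L.coreDirac.graph = L.coreGraph := by
  refine Submodule.toLinearPMap_graph_eq _ fun p hp hp0 => ?_
  obtain ⟨j, x, rfl⟩ := (L.mem_coreGraph p).1 hp
  have hx : x = 0 := Subtype.ext ((L.I_isometry j).injective (by simpa using hp0))
  simp [hx]

end InductiveRealization

end SpectralLimit

end

open SpectralLimit

/-! Let `P_j = I_j I_j^*` be the projection onto the range of `I_j`. Since `D` extends every `I_j
D_j`, its resolvent restricts to that of `D_j`, so `I_j R_z(D_j) I_j^* = R_z(D) P_j`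
(`lift_resolventOp`), and (ii), (iii) say that `R_z(D) P_j → R_z(D)` in norm. The `P_j` are
contractions tending strongly to `1`, so this holds when `R_z(D)` is compact
(`tendsto_comp_of_isCompactOperator`, after taking adjoints). Conversely, norm convergence at one
`z` makes `R_z(D)` a limit of compact operators, and the resolvent identity carries compactness to
the other points.

For (iv), `f(D)` is a continuous function of the normal operator `R_i(D)`, whose spectrum lies on a
fixed circle. The functional calculus commutes with `T ↦ I_j T I_j^*` and is norm continuous, so
convergence at `z = i` gives (iv); the choice `f(x) = (x - i)⁻¹` gives it back.

Of the selfadjointness of `D`, only its consequences are needed: `D` is closed, symmetric, and `D -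
z` has dense range for nonreal `z`. -/

namespace SpectralLimit

open scoped ComplexConjugate

/-! ### Resolvents of closed symmetric operators at nonreal points. -/

section Resolvent

variable {H : Type*} [NormedAddCommGroup H] [InnerProductSpace ℂ H] {D : H →ₗ.[ℂ] H}

/-- As `⟪x, D x⟫` is real, `⟪x, D x - z x⟫` has imaginary part `-(Im z) ‖x‖²`; Cauchy–Schwarz does
the rest. -/
theorem abs_im_mul_norm_le_of_symmetric (hD : D.IsFormalAdjoint D) (z : ℂ) (x : D.domain) :
    |z.im| * ‖(x : H)‖ ≤ ‖D x - z • (x : H)‖ := by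
  have hreal : (⟪(x : H), D x⟫_ℂ).im = 0 := by
    have h := hD x x
    rw [← inner_conj_symm] at h
    exact Complex.conj_eq_iff_im.1 h
  have him : (⟪(x : H), D x - z • (x : H)⟫_ℂ).im = -(z.im * ‖(x : H)‖ ^ 2) := by
    rw [inner_sub_right, inner_smul_right, inner_self_eq_norm_sq_to_K, Complex.sub_im, hreal]
    simp [← Complex.ofReal_pow]
  have h := (Complex.abs_im_le_norm _).trans
    (norm_inner_le_norm (𝕜 := ℂ) (x : H) (D x - z • (x : H)))
  rw [him, abs_neg, abs_mul, abs_of_nonneg (sq_nonneg ‖(x : H)‖)] at h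
  rcases (norm_nonneg (x : H)).eq_or_lt with h0 | h0
  · rw [← h0, mul_zero]
    exact norm_nonneg _
  · refine le_of_mul_le_mul_left ?_ h0
    linarith

variable [CompleteSpace H]

/-- A closed symmetric operator `D` has a resolvent at every nonreal `z` for which `D - z` has dense
range. -/
theorem exists_isResolventAt (hD : D.IsFormalAdjoint D) (hc : D.IsClosed) {z : ℂ} (hz : z.im ≠ 0)
    (hd : Dense (Set.range fun x : D.domain => D x - z • (x : H))) :
    ∃ R : H →L[ℂ] H, IsResolventAt D z R := by
  -- On the graph, complete because `D` is closed, `D - z` is bounded. Bounded below, it has closed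
  -- range, which is also dense, so it is invertible.
  let T : D.graph →L[ℂ] H :=
    (ContinuousLinearMap.snd ℂ H H - z • ContinuousLinearMap.fst ℂ H H) ∘L D.graph.subtypeL
  have hTx (x : D.domain) : T ⟨(x, D x), D.mem_graph x⟩ = D x - z • (x : H) := rfl
  have hG (p : D.graph) : ∃ x : D.domain, p = ⟨(x, D x), D.mem_graph x⟩ := by
    obtain ⟨⟨u, v⟩, hp⟩ := p
    obtain ⟨x, rfl, rfl⟩ := (LinearPMap.mem_graph_iff _).1 hp
    exact ⟨x, rfl⟩
  have hz' : 0 < |z.im| := abs_pos.2 hz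
  have : CompleteSpace D.graph := hc.completeSpace_coe
  -- The constant is the sum of the bounds for `x` and for `D x`, hence bounds their maximum, the
  -- norm on the graph.
  have hanti : AntilipschitzWith (Real.toNNReal (|z.im|⁻¹ + (1 + ‖z‖ * |z.im|⁻¹))) T := by
    refine AddMonoidHomClass.antilipschitz_of_bound T fun p => ?_
    obtain ⟨x, rfl⟩ := hG p
    rw [hTx, Real.coe_toNNReal _ (by positivity)]
    set w := D x - z • (x : H) with hw
    have h1 : ‖(x : H)‖ ≤ |z.im|⁻¹ * ‖w‖ := by
      rw [inv_mul_eq_div, le_div_iff₀ hz', mul_comm]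
      exact abs_im_mul_norm_le_of_symmetric hD z x
    have h2 : ‖D x‖ ≤ (1 + ‖z‖ * |z.im|⁻¹) * ‖w‖ := by
      have : D x = w + z • (x : H) := by rw [hw]; abel
      calc ‖D x‖ ≤ ‖w‖ + ‖z‖ * ‖(x : H)‖ := by
            rw [this]; exact (norm_add_le _ _).trans_eq (by rw [norm_smul])
        _ ≤ ‖w‖ + ‖z‖ * (|z.im|⁻¹ * ‖w‖) := by gcongr
        _ = _ := by ring
    have h3 : 0 ≤ ‖w‖ := norm_nonneg w
    have h4 : 0 ≤ |z.im|⁻¹ * ‖w‖ := by positivity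
    have h5 : 0 ≤ (1 + ‖z‖ * |z.im|⁻¹) * ‖w‖ := by positivity
    refine max_le ?_ ?_
    · change ‖(x : H)‖ ≤ _
      linarith
    · change ‖D x‖ ≤ _
      linarith
  have hrange : Set.range T = Set.univ := by
    rw [← (hanti.isClosed_range T.uniformContinuous).closure_eq]
    refine Dense.closure_eq (hd.mono ?_)
    rintro _ ⟨x, rfl⟩
    exact ⟨_, hTx x⟩
  let e : D.graph ≃L[ℂ] H := ContinuousLinearEquiv.ofBijective T
    (LinearMap.ker_eq_bot.2 hanti.injective) (LinearMap.range_eq_top.2 (Set.range_eq_univ.1 hrange))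
  have heT (p : D.graph) : e p = T p := rfl
  refine ⟨ContinuousLinearMap.fst ℂ H H ∘L D.graph.subtypeL ∘L (e.symm : H →L[ℂ] D.graph),
    fun y => ?_, fun x => ?_⟩
  · obtain ⟨x, hx⟩ := hG (e.symm y)
    have hy : y = D x - z • (x : H) := by rw [← hTx, ← hx, ← heT, e.apply_symm_apply]
    have hRy : (ContinuousLinearMap.fst ℂ H H ∘L D.graph.subtypeL ∘L
        (e.symm : H →L[ℂ] D.graph)) y = x := by
      change ((e.symm y : D.graph) : H × H).1 = x
      rw [hx]
    have hDx {u : H} (h : u ∈ D.domain) (hu : u = x) : D ⟨u, h⟩ = D x :=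
      congrArg D (Subtype.ext hu)
    refine ⟨hRy ▸ x.2, ?_⟩
    conv_rhs => rw [hy]
    exact congrArg₂ (· - z • ·) (hDx _ hRy) hRy
  · change ((e.symm (D x - z • (x : H)) : D.graph) : H × H).1 = x
    rw [← hTx, ← heT, e.symm_apply_apply]

theorem IsResolventAt.adjoint_eq (hD : D.IsFormalAdjoint D) {z : ℂ} {R R' : H →L[ℂ] H}
    (hR : IsResolventAt D z R) (hR' : IsResolventAt D (conj z) R') :
    ContinuousLinearMap.adjoint R = R' := by
  symm
  rw [ContinuousLinearMap.eq_adjoint_iff]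
  intro u v
  obtain ⟨hu, eu⟩ := hR'.1 u
  obtain ⟨hv, ev⟩ := hR.1 v
  conv_lhs => rw [← ev]
  conv_rhs => rw [← eu]
  have := hD ⟨R' u, hu⟩ ⟨R v, hv⟩
  simp only at this
  rw [inner_sub_left, inner_sub_right, inner_smul_left, inner_smul_right, this, Complex.conj_conj]

omit [CompleteSpace H] in
/-- The first resolvent identity. -/
theorem IsResolventAt.sub_eq {z w : ℂ} {R R' : H →L[ℂ] H}
    (hR : IsResolventAt D z R) (hR' : IsResolventAt D w R') : R' - R = (w - z) • (R' * R) := by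
  ext y
  obtain ⟨hy, ey⟩ := hR.1 y
  have h := hR'.2 ⟨R y, hy⟩
  have h2 : D ⟨R y, hy⟩ - w • R y = y - (w - z) • R y := by
    linear_combination (norm := module) ey
  rw [h2, map_sub, map_smul] at h
  change R' y - R y = (w - z) • R' (R y)
  linear_combination (norm := module) h

omit [CompleteSpace H] in
theorem IsResolventAt.isCompactOperator {z w : ℂ} {R R' : H →L[ℂ] H}
    (hR : IsResolventAt D z R) (hR' : IsResolventAt D w R') (hc : IsCompactOperator R) :
    IsCompactOperator R' := by
  have h : R' = R + (w - z) • (R' * R) := by rw [← hR.sub_eq hR']; abel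
  rw [h]
  exact hc.add ((hc.clm_comp R').smul (w - z))

theorem isFormalAdjoint_of_isSelfAdjoint (hD : IsSelfAdjoint D) : D.IsFormalAdjoint D := by
  have h := LinearPMap.adjoint_isFormalAdjoint hD.dense_domain
  rwa [LinearPMap.isSelfAdjoint_def.1 hD] at h

/-- A vector orthogonal to the range lies in `Dom D^* = Dom D` and satisfies `D y = conj z • y`; the
lower bound at `conj z` forces `y = 0`. -/
theorem dense_range_sub_smul_of_isSelfAdjoint (hD : IsSelfAdjoint D) {z : ℂ} (hz : z.im ≠ 0) :
    Dense (Set.range fun x : D.domain => D x - z • (x : H)) := by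
  let T : D.domain →ₗ[ℂ] H := D.toFun - z • D.domain.subtype
  have hT : (Set.range fun x : D.domain => D x - z • (x : H)) = (LinearMap.range T : Set H) := rfl
  rw [hT, Submodule.dense_iff_topologicalClosure_eq_top, Submodule.topologicalClosure_eq_top_iff,
    Submodule.eq_bot_iff]
  intro y hy
  have hy' (x : D.domain) : ⟪conj z • y, (x : H)⟫_ℂ = ⟪y, D x⟫_ℂ := by
    have := Submodule.mem_orthogonal' _ _ |>.1 hy _ (LinearMap.mem_range_self T x)
    have h2 : ⟪y, D x - z • (x : H)⟫_ℂ = 0 := this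
    rw [inner_sub_right, inner_smul_right, sub_eq_zero] at h2
    rw [inner_smul_left, Complex.conj_conj, h2]
  have hmem := LinearPMap.mem_adjoint_domain_of_exists (T := D) y ⟨_, hy'⟩
  have happ := LinearPMap.adjoint_apply_eq hD.dense_domain ⟨y, hmem⟩ hy'
  have hsa := LinearPMap.isSelfAdjoint_def.1 hD
  have hmem' : y ∈ D.domain := by rwa [hsa] at hmem
  have happ' : D ⟨y, hmem'⟩ = conj z • y := by
    rw [← happ]
    exact hsa.ge.2 (x := ⟨y, hmem'⟩) (y := ⟨y, hmem⟩) rfl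
  have h := abs_im_mul_norm_le_of_symmetric (isFormalAdjoint_of_isSelfAdjoint hD) (conj z)
    ⟨y, hmem'⟩
  rw [happ'] at h
  simp only [Complex.conj_im, abs_neg, sub_self, norm_zero] at h
  have h2 : ‖y‖ ≤ 0 := by
    by_contra! hlt
    exact absurd h (not_le.2 (mul_pos (abs_pos.2 hz) hlt))
  exact norm_le_zero_iff.1 h2

theorem isResolventAt_of_isSelfAdjoint (hD : IsSelfAdjoint D) {z : ℂ} (hz : z.im ≠ 0) :
    IsResolventAt D z (resolventOp D z) := by
  obtain ⟨R, hR⟩ := exists_isResolventAt (isFormalAdjoint_of_isSelfAdjoint hD) hD.isClosed hz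
    (dense_range_sub_smul_of_isSelfAdjoint hD hz)
  rwa [hR.resolventOp_eq]

end Resolvent

/-- Strong convergence of contractions is uniform on totally bounded sets, such as the image of the
unit ball under `K`. -/
theorem tendsto_comp_of_isCompactOperator {H : Type*} [NormedAddCommGroup H] [NormedSpace ℂ H]
    {P : ℕ → H →L[ℂ] H} (hP : ∀ j, ‖P j‖ ≤ 1) (hlim : ∀ x, Tendsto (fun j => P j x) atTop (𝓝 x))
    {K : H →L[ℂ] H} (hK : IsCompactOperator K) :
    Tendsto (fun j => P j ∘L K) atTop (𝓝 K) := by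
  obtain ⟨C, hC, hKC⟩ := hK.image_closedBall_subset_compact (f := (K : H →ₗ[ℂ] H)) 1
  have hPn (j : ℕ) (x : H) : ‖P j x‖ ≤ ‖x‖ := by simpa using (P j).le_of_opNorm_le (hP j) x
  rw [Metric.tendsto_atTop]
  intro ε hε
  -- The error splits as `ε/8 + ε/4 + ε/8 = ε/2`, with `c` a net point near `K x`.
  obtain ⟨t, -, htf, htc⟩ := Metric.totallyBounded_iff.1 hC.totallyBounded (ε / 8) (by positivity)
    |>.imp fun t h => (⟨trivial, h.1, h.2⟩ : True ∧ t.Finite ∧ _)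
  have hev : ∀ᶠ j in atTop, ∀ c ∈ t, dist (P j c) c < ε / 4 :=
    (Set.Finite.eventually_all htf).2 fun c _ =>
      Metric.tendsto_nhds.1 (hlim c) _ (by positivity)
  obtain ⟨N, hN⟩ := eventually_atTop.1 hev
  refine ⟨N, fun j hj => ?_⟩
  rw [dist_eq_norm]
  refine lt_of_le_of_lt ?_ (half_lt_self hε)
  refine ContinuousLinearMap.opNorm_le_of_unit_norm (𝕜 := ℂ) (by positivity) fun x hx => ?_
  have hKx : K x ∈ C := hKC ⟨x, by simp [hx], rfl⟩
  obtain ⟨c, hct, hxc⟩ := Set.mem_iUnion₂.1 (htc hKx)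
  rw [mem_ball_iff_norm] at hxc
  have h1 := hN j hj c hct
  rw [dist_eq_norm] at h1
  have h2 := hPn j (K x - c)
  have : (P j ∘L K - K) x = P j (K x - c) + (P j c - c) - (K x - c) := by
    change P j (K x) - K x = _
    rw [map_sub]
    abel
  rw [this]
  have := norm_sub_le (P j (K x - c) + (P j c - c)) (K x - c)
  have := norm_add_le (P j (K x - c)) (P j c - c)
  linarith

/-! ### The limit operator, its resolvent, and the equivalence of (i), (ii), (iii). -/

namespace InductiveRealization

variable {A H : ℕ → Type*} [∀ j, CStarAlgebra (A j)]
  [∀ j, NormedAddCommGroup (H j)] [∀ j, InnerProductSpace ℂ (H j)] [∀ j, CompleteSpace (H j)]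
  {S : InductiveSystem A H} {A' H' : Type*} [CStarAlgebra A'] [NormedAddCommGroup H']
  [InnerProductSpace ℂ H'] [CompleteSpace H'] (L : InductiveRealization S A' H')

theorem inner_I_I (j : ℕ) (x y : H j) : ⟪L.I j x, L.I j y⟫_ℂ = ⟪x, y⟫_ℂ :=
  LinearIsometry.inner_map_map
    ⟨(L.I j : H j →ₗ[ℂ] H'), (AddMonoidHomClass.isometry_iff_norm _).1 (L.I_isometry j)⟩ x y

theorem adjoint_I_comp_I (j : ℕ) :
    ContinuousLinearMap.adjoint (L.I j) ∘L L.I j = ContinuousLinearMap.id ℂ (H j) :=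
  (ContinuousLinearMap.norm_map_iff_adjoint_comp_self _).1
    ((AddMonoidHomClass.isometry_iff_norm _).1 (L.I_isometry j))

theorem adjoint_I_I (j : ℕ) (x : H j) : ContinuousLinearMap.adjoint (L.I j) (L.I j x) = x :=
  congr($(L.adjoint_I_comp_I j) x)

theorem mem_graph_coreDirac {p : H' × H'} : p ∈ L.coreDirac.graph ↔
    ∃ j, ∃ x : (S.triple j).D.domain, p = (L.I j x, L.I j ((S.triple j).D x)) := by
  rw [graph_coreDirac, mem_coreGraph]

theorem exists_eq_of_coreDirac {j k : ℕ} (hjk : j ≤ k) (x : (S.triple j).D.domain) :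
    ∃ y : (S.triple k).D.domain, L.I k y = L.I j x ∧
      L.I k ((S.triple k).D y) = L.I j ((S.triple j).D x) := by
  refine ⟨⟨_, (S.hom j k hjk).map_domain x x.2⟩, L.I_compat j k hjk x, ?_⟩
  rw [← (S.hom j k hjk).map_dirac x, L.I_compat j k hjk]

/-- Both pairs can be moved to the common level `max j k`, where `D_j` is symmetric. -/
theorem inner_eq_of_mem_graph_coreDirac {p q : H' × H'} (hp : p ∈ L.coreDirac.graph)
    (hq : q ∈ L.coreDirac.graph) : ⟪p.2, q.1⟫_ℂ = ⟪p.1, q.2⟫_ℂ := by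
  obtain ⟨j, x, rfl⟩ := L.mem_graph_coreDirac.1 hp
  obtain ⟨k, y, rfl⟩ := L.mem_graph_coreDirac.1 hq
  obtain ⟨x', hx, hx'⟩ := L.exists_eq_of_coreDirac (le_max_left j k) x
  obtain ⟨y', hy, hy'⟩ := L.exists_eq_of_coreDirac (le_max_right j k) y
  simp only
  rw [← hx, ← hx', ← hy, ← hy', inner_I_I, inner_I_I]
  exact isFormalAdjoint_of_isSelfAdjoint (S.triple (max j k)).selfAdjoint x' y'

theorem isFormalAdjoint_coreDirac : L.coreDirac.IsFormalAdjoint L.coreDirac := fun x y =>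
  L.inner_eq_of_mem_graph_coreDirac (L.coreDirac.mem_graph x) (L.coreDirac.mem_graph y)

theorem dense_domain_coreDirac : Dense (L.coreDirac.domain : Set H') := by
  refine dense_iff_closure_eq.2 (Set.eq_univ_of_univ_subset ?_)
  rw [← L.I_dense.closure_eq]
  refine closure_minimal (Set.iUnion_subset fun j => ?_) isClosed_closure
  rintro _ ⟨x, rfl⟩
  have hd : Dense ((S.triple j).D.domain : Set (H j)) := (S.triple j).selfAdjoint.dense_domain
  have hmem := image_closure_subset_closure_image (L.I j).continuous ⟨x, hd x, rfl⟩
  refine closure_mono ?_ hmem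
  rintro _ ⟨y, hy, rfl⟩
  exact LinearPMap.mem_domain_of_mem_graph (L.mem_graph_coreDirac.2 ⟨j, ⟨y, hy⟩, rfl⟩)

theorem isClosable_coreDirac : L.coreDirac.IsClosable :=
  (LinearPMap.adjoint_isClosed L.dense_domain_coreDirac).isClosable.leIsClosable
    (L.isFormalAdjoint_coreDirac.le_adjoint L.dense_domain_coreDirac)

theorem graph_dirac : L.dirac.graph = L.coreDirac.graph.topologicalClosure :=
  L.isClosable_coreDirac.graph_closure_eq_closure_graph.symm

theorem isClosed_dirac : L.dirac.IsClosed := L.isClosable_coreDirac.closure_isClosed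

theorem isFormalAdjoint_dirac : L.dirac.IsFormalAdjoint L.dirac := by
  have key (p q : H' × H') (hp : p ∈ closure (L.coreDirac.graph : Set (H' × H')))
      (hq : q ∈ closure (L.coreDirac.graph : Set (H' × H'))) : ⟪p.2, q.1⟫_ℂ = ⟪p.1, q.2⟫_ℂ := by
    have hpq : (p, q) ∈ closure ((L.coreDirac.graph : Set (H' × H')) ×ˢ
        (L.coreDirac.graph : Set (H' × H'))) := by
      rw [closure_prod_eq]
      exact ⟨hp, hq⟩
    have hcl : IsClosed {r : (H' × H') × (H' × H') | ⟪r.1.2, r.2.1⟫_ℂ = ⟪r.1.1, r.2.2⟫_ℂ} :=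
      isClosed_eq (by fun_prop) (by fun_prop)
    exact closure_minimal (fun r hr => L.inner_eq_of_mem_graph_coreDirac hr.1 hr.2) hcl hpq
  intro x y
  have hg (x : L.dirac.domain) :
      ((x : H'), L.dirac x) ∈ closure (L.coreDirac.graph : Set (H' × H')) := by
    have := L.dirac.mem_graph x
    rwa [graph_dirac] at this
  exact key _ _ (hg x) (hg y)

theorem exists_dirac_I {j : ℕ} (x : (S.triple j).D.domain) :
    ∃ h : L.I j x ∈ L.dirac.domain, L.dirac ⟨L.I j x, h⟩ = L.I j ((S.triple j).D x) := by
  have h : (L.I j x, L.I j ((S.triple j).D x)) ∈ L.dirac.graph := by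
    rw [graph_dirac]
    exact Submodule.le_topologicalClosure _ (L.mem_graph_coreDirac.2 ⟨j, x, rfl⟩)
  obtain ⟨y, hy, hy'⟩ := (LinearPMap.mem_graph_iff _).1 h
  simp only at hy hy'
  have hm : L.I j x ∈ L.dirac.domain := hy ▸ y.2
  exact ⟨hm, by rw [← hy']; exact congrArg _ (Subtype.ext hy.symm)⟩

/-- The range contains every `I_j H_j`, since `D_j - z` is already onto `H_j`. -/
theorem dense_range_dirac_sub_smul {z : ℂ} (hz : z.im ≠ 0) :
    Dense (Set.range fun x : L.dirac.domain => L.dirac x - z • (x : H')) := by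
  refine L.I_dense.mono (Set.iUnion_subset fun j => ?_)
  rintro _ ⟨y, rfl⟩
  obtain ⟨h, e⟩ := (isResolventAt_of_isSelfAdjoint (S.triple j).selfAdjoint hz).1 y
  obtain ⟨h', e'⟩ := L.exists_dirac_I ⟨_, h⟩
  refine ⟨⟨_, h'⟩, ?_⟩
  simp only at e' ⊢
  rw [e', ← map_smul, ← map_sub, e]

theorem isResolventAt_dirac {z : ℂ} (hz : z.im ≠ 0) :
    IsResolventAt L.dirac z (resolventOp L.dirac z) := by
  obtain ⟨R, hR⟩ := exists_isResolventAt L.isFormalAdjoint_dirac L.isClosed_dirac hz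
    (L.dense_range_dirac_sub_smul hz)
  rwa [hR.resolventOp_eq]

/-- The resolvent of the limit operator restricts to the resolvents of the operators `D_j`. -/
theorem resolventOp_dirac_I {z : ℂ} (hz : z.im ≠ 0) (j : ℕ) (y : H j) :
    resolventOp L.dirac z (L.I j y) = L.I j (resolventOp (S.triple j).D z y) := by
  obtain ⟨h, e⟩ := (isResolventAt_of_isSelfAdjoint (S.triple j).selfAdjoint hz).1 y
  obtain ⟨h', e'⟩ := L.exists_dirac_I ⟨_, h⟩
  have := (L.isResolventAt_dirac hz).2 ⟨_, h'⟩
  simp only at e' this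
  rwa [e', ← map_smul, ← map_sub, e] at this

theorem lift_resolventOp {z : ℂ} (hz : z.im ≠ 0) (j : ℕ) :
    L.lift j (resolventOp (S.triple j).D z) =
      resolventOp L.dirac z ∘L L.lift j (ContinuousLinearMap.id ℂ (H j)) := by
  ext x
  exact (L.resolventOp_dirac_I hz j _).symm

theorem adjoint_lift (j : ℕ) (T : H j →L[ℂ] H j) :
    ContinuousLinearMap.adjoint (L.lift j T) = L.lift j (ContinuousLinearMap.adjoint T) := by
  simp only [lift, ContinuousLinearMap.adjoint_comp, ContinuousLinearMap.adjoint_adjoint,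
    ContinuousLinearMap.comp_assoc]

/-- The conjugation `T ↦ I_j T I_j^*` as a homomorphism of C⋆-algebras. -/
noncomputable def liftHom (j : ℕ) : (H j →L[ℂ] H j) →⋆ₙₐ[ℂ] (H' →L[ℂ] H') where
  toFun := L.lift j
  map_smul' c T := by ext; simp [lift]
  map_zero' := by ext; simp [lift]
  map_add' T T' := by ext; simp [lift]
  -- This rests on `I_j^* I_j = 1`. The map is not unital: it sends `1` to `P_j`.
  map_mul' T T' := by ext; simp [lift, adjoint_I_I]
  map_star' T := (L.adjoint_lift j T).symm

theorem norm_lift_id_le (j : ℕ) : ‖L.lift j (ContinuousLinearMap.id ℂ (H j))‖ ≤ 1 := by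
  have hI : ‖L.I j‖ ≤ 1 := (L.I j).opNorm_le_bound zero_le_one fun x => by
    rw [one_mul, (AddMonoidHomClass.isometry_iff_norm _).1 (L.I_isometry j)]
  refine (ContinuousLinearMap.opNorm_comp_le _ _).trans (mul_le_one₀ hI (norm_nonneg _) ?_)
  rw [ContinuousLinearMap.id_comp, LinearIsometryEquiv.norm_map]
  exact hI

theorem lift_id_I {j k : ℕ} (hjk : j ≤ k) (x : H j) :
    L.lift k (ContinuousLinearMap.id ℂ (H k)) (L.I j x) = L.I j x := by
  rw [← L.I_compat j k hjk]
  exact congrArg (L.I k) (L.adjoint_I_I k _)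

/-- `P_j` fixes `I_k y` once `j ≥ k`; density and the uniform bound on `‖P_j‖` extend this to all
vectors. -/
theorem tendsto_lift_id (x : H') :
    Tendsto (fun j => L.lift j (ContinuousLinearMap.id ℂ (H j)) x) atTop (𝓝 x) := by
  rw [Metric.tendsto_atTop]
  intro ε hε
  obtain ⟨_, hy, hxy⟩ := Metric.mem_closure_iff.1 (L.I_dense x) (ε / 2) (half_pos hε)
  obtain ⟨k, y, rfl⟩ := Set.mem_iUnion.1 hy
  refine ⟨k, fun j hj => ?_⟩
  have h1 := (L.lift j (ContinuousLinearMap.id ℂ (H j))).le_of_opNorm_le (L.norm_lift_id_le j)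
    (x - L.I k y)
  rw [map_sub, L.lift_id_I hj, one_mul, ← dist_eq_norm, ← dist_eq_norm] at h1
  have h2 := dist_triangle_right (L.lift j (ContinuousLinearMap.id ℂ (H j)) x) x (L.I k y)
  linarith

theorem tendsto_resolventOp_of_hasCompactResolvent (h : HasCompactResolvent L.dirac) {z : ℂ}
    (hz : z.im ≠ 0) :
    Tendsto (fun j => L.lift j (resolventOp (S.triple j).D z)) atTop
      (𝓝 (resolventOp L.dirac z)) := by
  -- Compactness controls `P_j K`, but `R_z(D) P_j` has the projection on the right. So `K = R_{conj
  -- z}(D)` is used, and adjoints are taken.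
  have hz' : (conj z).im ≠ 0 := by simpa using hz
  have hR := L.isResolventAt_dirac hz'
  have hc := h (conj z) ⟨_, hR⟩
  have hlim := tendsto_comp_of_isCompactOperator L.norm_lift_id_le L.tendsto_lift_id hc
  have hadj : ContinuousLinearMap.adjoint (resolventOp L.dirac (conj z)) = resolventOp L.dirac z :=
    hR.adjoint_eq L.isFormalAdjoint_dirac (by simpa using L.isResolventAt_dirac hz)
  have hlim' := (ContinuousLinearMap.adjoint (𝕜 := ℂ) (E := H') (F := H')).continuous.tendsto _
    |>.comp hlim
  rw [hadj] at hlim'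
  refine hlim'.congr fun j => ?_
  rw [Function.comp_apply, ContinuousLinearMap.adjoint_comp, hadj, adjoint_lift,
    ContinuousLinearMap.adjoint_id, lift_resolventOp _ hz]

theorem hasCompactResolvent_of_tendsto {z : ℂ} (hz : z.im ≠ 0)
    (h : Tendsto (fun j => L.lift j (resolventOp (S.triple j).D z)) atTop
      (𝓝 (resolventOp L.dirac z))) : HasCompactResolvent L.dirac := by
  rintro w ⟨R, hR⟩
  have hc : IsCompactOperator (resolventOp L.dirac z) := by
    refine isCompactOperator_of_tendsto h (Eventually.of_forall fun j => ?_)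
    have hj := (S.triple j).compactResolvent z
      ⟨_, isResolventAt_of_isSelfAdjoint (S.triple j).selfAdjoint hz⟩
    exact (hj.comp_clm (ContinuousLinearMap.adjoint (L.I j))).clm_comp (L.I j)
  rw [hR.resolventOp_eq]
  exact (L.isResolventAt_dirac hz).isCompactOperator hR hc

end InductiveRealization

/-! ### Functions of `D` as functions of `(D - i)⁻¹`. -/

section FunctionalCalculus

/-- The circle with diameter `[0, i]`, which contains the spectrum of `(D - i)⁻¹` for every
selfadjoint `D`. -/
def resolventCircle : Set ℂ := {z | z.im = Complex.normSq z}

/-- The function on `resolventCircle` through which `funCalc` is defined. -/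
noncomputable def resolventSymbol (f : C₀(ℝ, ℂ)) (z : ℂ) : ℂ :=
  if z = 0 then 0 else f (z⁻¹ + Complex.I).re

/-- Away from `0`, the circle equation `Im z = |z|²` says exactly that `Im z⁻¹ = -1`. -/
theorem inv_add_I_eq_ofReal {z : ℂ} (hz : z ∈ resolventCircle) (h0 : z ≠ 0) :
    z⁻¹ + Complex.I = ((z⁻¹ + Complex.I).re : ℂ) := by
  have hn : Complex.normSq z ≠ 0 := by simpa using h0
  refine Complex.ext rfl ?_
  rw [Complex.ofReal_im, Complex.add_im, Complex.inv_im, Complex.I_im, show z.im = _ from hz,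
    neg_div, div_self hn, neg_add_cancel]

theorem isCompact_resolventCircle : IsCompact resolventCircle := by
  refine (isCompact_closedBall (0 : ℂ) 1).of_isClosed_subset
    (isClosed_eq Complex.continuous_im Complex.continuous_normSq) fun z hz => ?_
  have h1 : z.im = ‖z‖ ^ 2 := by rw [← Complex.normSq_eq_norm_sq]; exact hz
  have h2 := (le_abs_self _).trans (Complex.abs_im_le_norm z)
  rw [mem_closedBall_zero_iff]
  nlinarith [norm_nonneg z]

theorem continuousOn_resolventSymbol (f : C₀(ℝ, ℂ)) :
    ContinuousOn (resolventSymbol f) resolventCircle := by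
  intro z hz
  by_cases h0 : z = 0
  · subst h0
    -- As `z → 0` on the circle, `z⁻¹ + i` is real and its modulus tends to infinity, where `f`
    -- vanishes.
    have hlim : Tendsto (fun z : ℂ => f (z⁻¹ + Complex.I).re) (𝓝[resolventCircle \ {0}] 0)
        (𝓝 0) := by
      refine (zero_at_infty f).comp ?_
      rw [← Metric.cobounded_eq_cocompact, ← tendsto_norm_atTop_iff_cobounded]
      have h1 : Tendsto (fun z : ℂ => ‖z⁻¹‖ - 1) (𝓝[resolventCircle \ {0}] 0) atTop := by
        refine tendsto_atTop_add_const_right _ _ ?_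
        exact tendsto_norm_inv_nhdsNE_zero_atTop.mono_left
          (nhdsWithin_mono _ fun x hx => hx.2)
      refine tendsto_atTop_mono' _ ?_ h1
      filter_upwards [self_mem_nhdsWithin] with w hw
      have h2 := inv_add_I_eq_ofReal hw.1 hw.2
      have h3 : ‖w⁻¹ + Complex.I‖ = ‖(w⁻¹ + Complex.I).re‖ := by
        rw [h2, Complex.norm_real, Complex.ofReal_re]
      have h4 := norm_sub_le (w⁻¹ + Complex.I) Complex.I
      rw [add_sub_cancel_right, Complex.norm_I, h3] at h4
      exact sub_le_iff_le_add.2 h4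
    rw [← continuousWithinAt_sdiff_self, ContinuousWithinAt, resolventSymbol, if_pos rfl]
    refine hlim.congr' ?_
    filter_upwards [self_mem_nhdsWithin] with w hw
    exact (if_neg hw.2).symm
  · refine ContinuousAt.continuousWithinAt ?_
    have hc : ContinuousAt (fun z : ℂ => f (z⁻¹ + Complex.I).re) z :=
      f.continuous.continuousAt.comp
        (Complex.continuous_re.continuousAt.comp ((continuousAt_inv₀ h0).add continuousAt_const))
    refine hc.congr ?_
    filter_upwards [isOpen_ne.mem_nhds h0] with w hw
    exact (if_neg hw).symm

theorem resolventSymbol_zero (f : C₀(ℝ, ℂ)) : resolventSymbol f 0 = 0 := if_pos rfl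

/-- The function `x ↦ (x - i)⁻¹`, as a continuous function vanishing at infinity. -/
noncomputable def resolventFunction : C₀(ℝ, ℂ) where
  toFun x := ((x : ℂ) - Complex.I)⁻¹
  continuous_toFun := by
    refine Continuous.inv₀ (by fun_prop) fun x h => ?_
    simpa using congrArg Complex.im h
  zero_at_infty' := by
    refine tendsto_inv₀_cobounded.comp ?_
    rw [← Metric.cobounded_eq_cocompact, ← tendsto_norm_atTop_iff_cobounded]
    refine tendsto_atTop_mono (fun x => ?_)
      (tendsto_norm_cobounded_atTop (E := ℝ))
    simpa using Complex.abs_re_le_norm ((x : ℂ) - Complex.I)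

theorem eqOn_resolventSymbol_resolventFunction :
    resolventCircle.EqOn (resolventSymbol resolventFunction) id := by
  intro z hz
  by_cases h0 : z = 0
  · rw [h0, resolventSymbol_zero, id]
  · rw [resolventSymbol, if_neg h0]
    change (((z⁻¹ + Complex.I).re : ℂ) - Complex.I)⁻¹ = z
    rw [← inv_add_I_eq_ofReal hz h0, add_sub_cancel_right, inv_inv]

variable {H : Type*} [NormedAddCommGroup H] [InnerProductSpace ℂ H] [CompleteSpace H]
  {D : H →ₗ.[ℂ] H} {R : H →L[ℂ] H}

/-- The functional calculus turns the identity for `R` into `z - conj z = 2i |z|²` on the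
quasispectrum, the equation of the circle. -/
theorem quasispectrum_subset_resolventCircle [IsStarNormal R]
    (h : R - star R = (2 * Complex.I) • (R * star R)) :
    quasispectrum ℂ R ⊆ resolventCircle := by
  have h1 : cfcₙ (fun z : ℂ => z - star z) R =
      cfcₙ (fun z : ℂ => (2 * Complex.I) • (z * star z)) R := by
    rw [cfcₙ_sub (fun z : ℂ => z) (fun z => star z) R,
      cfcₙ_smul (2 * Complex.I) (fun z : ℂ => z * star z) R,
      cfcₙ_mul (fun z : ℂ => z) (fun z => star z) R, cfcₙ_star_id (R := ℂ) (a := R), cfcₙ_id' ℂ R]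
    exact h
  intro z hz
  have h2 := eqOn_of_cfcₙ_eq_cfcₙ h1 (by infer_instance) (by fun_prop) (by simp) (by fun_prop)
    (by simp) hz
  have h3 := congrArg Complex.im h2
  simp [Complex.mul_conj] at h3
  change z.im = Complex.normSq z
  linarith

/-- Since `R^*` is the resolvent at `-i`, the resolvent identity taken in both orders shows that `R`
and `R^*` commute and gives `R - R^* = 2i R R^*`. -/
theorem IsResolventAt.isStarNormal_and_quasispectrum_subset
    (hD : D.IsFormalAdjoint D) {R' : H →L[ℂ] H}
    (hR : IsResolventAt D Complex.I R) (hR' : IsResolventAt D (-Complex.I) R') :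
    IsStarNormal R ∧ quasispectrum ℂ R ⊆ resolventCircle := by
  have hstar : star R = R' := hR.adjoint_eq hD (by simpa using hR')
  have h1 := hR.sub_eq hR'
  have h2 := hR'.sub_eq hR
  have h3 : R' * R = R * R' := by
    have : (2 * Complex.I) • (R' * R) = (2 * Complex.I) • (R * R') := by
      linear_combination (norm := module) h1 + h2
    exact smul_right_injective _ (by simp) this
  have hn : IsStarNormal R := ⟨by rw [hstar]; exact h3⟩
  refine ⟨hn, quasispectrum_subset_resolventCircle ?_⟩
  rw [hstar, h2]
  module

theorem funCalc_resolventFunction (hn : IsStarNormal (resolventOp D Complex.I))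
    (hs : quasispectrum ℂ (resolventOp D Complex.I) ⊆ resolventCircle) :
    funCalc D resolventFunction = resolventOp D Complex.I := by
  change cfcₙ (resolventSymbol resolventFunction) _ = _
  rw [cfcₙ_congr (eqOn_resolventSymbol_resolventFunction.mono hs), cfcₙ_id ℂ _]

end FunctionalCalculus

/-! ### Convergence of the functional calculus, for (iv). -/

namespace InductiveRealization

variable {A H : ℕ → Type*} [∀ j, CStarAlgebra (A j)]
  [∀ j, NormedAddCommGroup (H j)] [∀ j, InnerProductSpace ℂ (H j)] [∀ j, CompleteSpace (H j)]
  {S : InductiveSystem A H} {A' H' : Type*} [CStarAlgebra A'] [NormedAddCommGroup H']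
  [InnerProductSpace ℂ H'] [CompleteSpace H'] (L : InductiveRealization S A' H')

theorem isStarNormal_resolventOp_dirac : IsStarNormal (resolventOp L.dirac Complex.I) ∧
    quasispectrum ℂ (resolventOp L.dirac Complex.I) ⊆ resolventCircle :=
  (L.isResolventAt_dirac (by simp)).isStarNormal_and_quasispectrum_subset L.isFormalAdjoint_dirac
    (L.isResolventAt_dirac (by simp))

theorem isStarNormal_resolventOp (S : InductiveSystem A H) (j : ℕ) :
    IsStarNormal (resolventOp (S.triple j).D Complex.I) ∧
    quasispectrum ℂ (resolventOp (S.triple j).D Complex.I) ⊆ resolventCircle :=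
  (isResolventAt_of_isSelfAdjoint (S.triple j).selfAdjoint (by simp))
    |>.isStarNormal_and_quasispectrum_subset
      (isFormalAdjoint_of_isSelfAdjoint (S.triple j).selfAdjoint)
    (isResolventAt_of_isSelfAdjoint (S.triple j).selfAdjoint (by simp))

theorem tendsto_funCalc_of_tendsto_resolventOp
    (h : Tendsto (fun j => L.lift j (resolventOp (S.triple j).D Complex.I)) atTop
      (𝓝 (resolventOp L.dirac Complex.I))) (f : C₀(ℝ, ℂ)) :
    Tendsto (fun j => L.lift j (funCalc (S.triple j).D f)) atTop (𝓝 (funCalc L.dirac f)) := by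
  have hn (j : ℕ) : IsStarNormal (L.liftHom j (resolventOp (S.triple j).D Complex.I)) :=
    have := (isStarNormal_resolventOp S j).1
    IsStarNormal.map (L.liftHom j) _
  -- The non-unital calculus is needed since `liftHom` is not unital; it applies because the symbol
  -- vanishes at `0`.
  have hmap (j : ℕ) : L.lift j (funCalc (S.triple j).D f) =
      cfcₙ (resolventSymbol f) (L.liftHom j (resolventOp (S.triple j).D Complex.I)) := by
    have hj := isStarNormal_resolventOp S j
    exact NonUnitalStarAlgHom.map_cfcₙ (L.liftHom j) (resolventSymbol f) _
      ((continuousOn_resolventSymbol f).mono hj.2) (resolventSymbol_zero f)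
      (map_continuous (L.liftHom j)) hj.1 (hn j)
  simp only [hmap]
  -- One compact circle contains the quasispectra of all the operators, so the calculus is
  -- continuous along the sequence.
  refine Filter.Tendsto.cfcₙ isCompact_resolventCircle (resolventSymbol f) h
    (Eventually.of_forall fun j => ?_) (Eventually.of_forall hn)
    L.isStarNormal_resolventOp_dirac.2 L.isStarNormal_resolventOp_dirac.1
    (continuousOn_resolventSymbol f) (resolventSymbol_zero f)
  exact (NonUnitalAlgHom.quasispectrum_apply_subset' ℂ (L.liftHom j) _).trans
    (isStarNormal_resolventOp S j).2

theorem tendsto_resolventOp_of_tendsto_funCalc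
    (h : Tendsto (fun j => L.lift j (funCalc (S.triple j).D resolventFunction)) atTop
      (𝓝 (funCalc L.dirac resolventFunction))) :
    Tendsto (fun j => L.lift j (resolventOp (S.triple j).D Complex.I)) atTop
      (𝓝 (resolventOp L.dirac Complex.I)) := by
  rw [funCalc_resolventFunction L.isStarNormal_resolventOp_dirac.1
    L.isStarNormal_resolventOp_dirac.2] at h
  refine h.congr fun j => ?_
  rw [funCalc_resolventFunction (isStarNormal_resolventOp S j).1 (isStarNormal_resolventOp S j).2]

end InductiveRealization

end SpectralLimit

theorem theorem3p1 {A H : ℕ → Type*} [∀ j, CStarAlgebra (A j)]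
    [∀ j, NormedAddCommGroup (H j)] [∀ j, InnerProductSpace ℂ (H j)] [∀ j, CompleteSpace (H j)]
    (S : InductiveSystem A H)
    {A' H' : Type*} [CStarAlgebra A'] [NormedAddCommGroup H'] [InnerProductSpace ℂ H']
    [CompleteSpace H'] (L : InductiveRealization S A' H') :
    List.TFAE [
      HasCompactResolvent L.dirac,
      ∀ z : ℂ, z.im ≠ 0 →
        Tendsto (fun j => L.lift j (resolventOp (S.triple j).D z)) atTop (𝓝 (resolventOp L.dirac z)),
      ∃ z : ℂ, z.im ≠ 0 ∧
        Tendsto (fun j => L.lift j (resolventOp (S.triple j).D z)) atTop (𝓝 (resolventOp L.dirac z)),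
      ∀ f : C₀(ℝ, ℂ),
        Tendsto (fun j => L.lift j (funCalc (S.triple j).D f)) atTop (𝓝 (funCalc L.dirac f))] := by
  tfae_have 1 → 2 := fun h _ hz => L.tendsto_resolventOp_of_hasCompactResolvent h hz
  tfae_have 2 → 3 := fun h => ⟨Complex.I, by simp, h _ (by simp)⟩
  tfae_have 3 → 1 := fun ⟨_, hz, h⟩ => L.hasCompactResolvent_of_tendsto hz h
  tfae_have 2 → 4 := fun h => L.tendsto_funCalc_of_tendsto_resolventOp (h _ (by simp))
  tfae_have 4 → 3 := fun h =>
    ⟨Complex.I, by simp, L.tendsto_resolventOp_of_tendsto_funCalc (h resolventFunction)⟩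
  tfae_finish
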